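/- Let $X$ be a completely regular Hausdorff space, let $C(X)$ be the ring of real-valued continuous functions on $X$, and let $\mathcal{M}(C(X))$ be the space of minimal prime ideals of $C(X)$ with the Zariski topology, in which the sets $D(f)=\{P\in\mathcal{M}(C(X)) : f\notin P\}$, $f\in C(X)$, form a basis of open sets. Then the set of isolated points of $X$ is dense in $X$ if and only if the set of isolated points of $\mathcal{M}(C(X))$ is dense in $\mathcal{M}(C(X))$. -/

import Mathlib

/-- The space of minimal prime ideals of a commutative ring `R`, a subspace of the prime spectrum
with its Zariski topology. -/
abbrev MinimalPrimeSpace (R : Type*) [CommRing R] : Type _ :=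
  {P : PrimeSpectrum R // P.asIdeal ∈ minimalPrimes R}

/-- The sets `D(a) = {P | a ∉ P}` form a basis of the topology of the minimal prime space. -/
theorem MinimalPrimeSpace.isTopologicalBasis (R : Type*) [CommRing R] :
    TopologicalSpace.IsTopologicalBasis
      (Set.range fun a : R => {P : MinimalPrimeSpace R | a ∉ P.1.asIdeal}) := by
  have h := (PrimeSpectrum.isTopologicalBasis_basic_opens (R := R)).isInducing
    (Topology.IsInducing.subtypeVal (t := fun P : PrimeSpectrum R => P.asIdeal ∈ minimalPrimes R))
  rw [← Set.range_comp] at h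
  exact h

/-- The set `I(X)` of isolated points of a topological space `X`. -/
def isolatedPoints (X : Type*) [TopologicalSpace X] : Set X :=
  {x | IsOpen ({x} : Set X)}

section ReducedRing

variable {R : Type*} [CommRing R]

/-! An isolated point `x` gives the isolated minimal prime of functions vanishing at `x`.
Conversely, if `P` is isolated and `f ∉ P`, some multiple `b` of `f` has `D(b) = {P}`; such a `b` is
nonzero at a single point, which is therefore isolated and lies where `f ≠ 0`. -/

theorem MinimalPrimeSpace.exists_notMem [IsReduced R] {a : R} (ha : a ≠ 0) :
    ∃ P : MinimalPrimeSpace R, a ∉ P.1.asIdeal := by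
  by_contra! h
  apply ha
  have hmem : a ∈ sInf (minimalPrimes R) := by
    rw [Submodule.mem_sInf]
    intro I hI
    exact h ⟨⟨I, hI.1.1⟩, hI⟩
  have hnil : sInf (minimalPrimes R) = nilradical R := Ideal.sInf_minimalPrimes
  rw [hnil, mem_nilradical] at hmem
  exact hmem.eq_zero

theorem MinimalPrimeSpace.isOpen_notMem (a : R) :
    IsOpen {P : MinimalPrimeSpace R | a ∉ P.1.asIdeal} :=
  (MinimalPrimeSpace.isTopologicalBasis R).isOpen ⟨a, rfl⟩

/-- Two minimal primes agree as soon as one is contained in the other. -/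
theorem MinimalPrimeSpace.ext_of_le {P Q : MinimalPrimeSpace R}
    (h : P.1.asIdeal ≤ Q.1.asIdeal) : P = Q :=
  Subtype.ext (PrimeSpectrum.ext (le_antisymm h (Q.2.2 P.2.1 h)))

/-- If the annihilator of `e` contains a prime `P` that does not contain `e`, then `P` is an
isolated point of the space of minimal primes. -/
theorem MinimalPrimeSpace.exists_isolated_of_mul_eq_zero {P : Ideal R} [hP : P.IsPrime] {e : R}
    (he : e ∉ P) (hann : ∀ f ∈ P, f * e = 0) :
    ∃ Q ∈ isolatedPoints (MinimalPrimeSpace R), Q.1.asIdeal = P := by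
  -- Used twice: for minimality of `P`, and for `D(e) = {P}`.
  have key : ∀ I : Ideal R, I.IsPrime → e ∉ I → P ≤ I := fun I hI heI f hf =>
    (hI.mem_or_mem (hann f hf ▸ I.zero_mem)).resolve_right heI
  have hmin : P ∈ minimalPrimes R :=
    ⟨⟨hP, bot_le⟩, fun I hI hle => key I hI.1 fun h => he (hle h)⟩
  refine ⟨⟨⟨P, hP⟩, hmin⟩, ?_, rfl⟩
  have hset : {Q : MinimalPrimeSpace R | e ∉ Q.1.asIdeal} = {⟨⟨P, hP⟩, hmin⟩} := by
    ext Q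
    constructor
    · intro hQ
      exact (MinimalPrimeSpace.ext_of_le (P := ⟨⟨P, hP⟩, hmin⟩) (key _ Q.1.2 hQ)).symm
    · rintro rfl
      exact he
  have hopen := MinimalPrimeSpace.isOpen_notMem e
  rwa [hset] at hopen

/-- In a reduced ring `D(a)` is empty only for `a = 0`. -/
theorem MinimalPrimeSpace.dense_isolatedPoints_iff [IsReduced R] :
    Dense (isolatedPoints (MinimalPrimeSpace R)) ↔
      ∀ a : R, a ≠ 0 → ∃ P ∈ isolatedPoints (MinimalPrimeSpace R), a ∉ P.1.asIdeal := by
  rw [(MinimalPrimeSpace.isTopologicalBasis R).dense_iff]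
  constructor
  · intro h a ha
    obtain ⟨P, haP, hP⟩ := h _ ⟨a, rfl⟩ (MinimalPrimeSpace.exists_notMem ha)
    exact ⟨P, hP, haP⟩
  · rintro h _ ⟨a, rfl⟩ ⟨Q, hQ⟩
    have ha : a ≠ 0 := by
      rintro rfl
      exact hQ Q.1.asIdeal.zero_mem
    obtain ⟨P, hP, haP⟩ := h a ha
    exact ⟨P, haP, hP⟩

/-- Every isolated minimal prime in `D(f)` is cut out by some multiple of `f`. -/
theorem MinimalPrimeSpace.exists_mul_notMem_iff_eq {P : MinimalPrimeSpace R}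
    (hP : P ∈ isolatedPoints (MinimalPrimeSpace R)) {f : R} (hf : f ∉ P.1.asIdeal) :
    ∃ a : R, ∀ Q : MinimalPrimeSpace R, a * f ∉ Q.1.asIdeal ↔ Q = P := by
  obtain ⟨_, ⟨a, rfl⟩, haP, hsub⟩ :=
    (MinimalPrimeSpace.isTopologicalBasis R).exists_subset_of_mem_open
      (Set.mem_singleton P) hP
  refine ⟨a, fun Q => ⟨fun h => hsub fun ha => h (Ideal.mul_mem_right _ _ ha), ?_⟩⟩
  rintro rfl h
  exact (Q.1.2.mem_or_mem h).elim haP hf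

end ReducedRing

section ContinuousFunctions

variable {X : Type*} [TopologicalSpace X]

theorem ContinuousMap.exists_ne_zero_of_mem_isOpen [CompletelyRegularSpace X] {U : Set X}
    (hU : IsOpen U) {x : X} (hx : x ∈ U) :
    ∃ f : C(X, ℝ), f x ≠ 0 ∧ ∀ y ∉ U, f y = 0 := by
  obtain ⟨g, hg, hgx, hgU⟩ :=
    CompletelyRegularSpace.completely_regular x Uᶜ hU.isClosed_compl (by simpa using hx)
  refine ⟨⟨fun y => 1 - (g y : ℝ), by fun_prop⟩, by simp [hgx], fun y hy => ?_⟩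
  simp [hgU hy]

instance ContinuousMap.isReduced_real : IsReduced C(X, ℝ) where
  eq_zero f := by
    rintro ⟨n, hn⟩
    ext z
    exact eq_zero_of_pow_eq_zero (DFunLike.congr_fun hn z)

/-- A function `e` nonzero only at `x` is annihilated by everything vanishing at `x`. -/
theorem ContinuousMap.exists_isolated_minimalPrime [CompletelyRegularSpace X] {x : X}
    (hx : x ∈ isolatedPoints X) :
    ∃ P ∈ isolatedPoints (MinimalPrimeSpace C(X, ℝ)),
      ∀ f : C(X, ℝ), f ∈ P.1.asIdeal ↔ f x = 0 := by
  let φ : C(X, ℝ) →+* ℝ := (Pi.evalRingHom _ x).comp ContinuousMap.coeFnRingHom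
  have hφ : ∀ f : C(X, ℝ), f ∈ RingHom.ker φ ↔ f x = 0 := fun f => Iff.rfl
  have : (RingHom.ker φ).IsPrime := RingHom.ker_isPrime _
  obtain ⟨e, hex, he⟩ := exists_ne_zero_of_mem_isOpen hx (Set.mem_singleton x)
  obtain ⟨P, hP, hPφ⟩ := MinimalPrimeSpace.exists_isolated_of_mul_eq_zero (P := RingHom.ker φ)
    (e := e) hex fun f hf => by
      ext y
      by_cases hy : y = x
      · subst hy
        simp [(hφ f).1 hf]
      · simp [he y hy]
  exact ⟨P, hP, fun f => hPφ ▸ hφ f⟩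

/-- If `D(b)` is a single minimal prime, then `b` is nonzero at exactly one point. -/
theorem ContinuousMap.eq_of_ne_zero_of_notMem_iff_eq [T35Space X]
    {P : MinimalPrimeSpace C(X, ℝ)} {b : C(X, ℝ)}
    (hb : ∀ Q : MinimalPrimeSpace C(X, ℝ), b ∉ Q.1.asIdeal ↔ Q = P)
    {x y : X} (hx : b x ≠ 0) (hy : b y ≠ 0) : x = y := by
  by_contra hxy
  obtain ⟨U, V, hU, hV, hxU, hyV, hUV⟩ := t2_separation hxy
  -- A minimal prime missing `g * b` lies in `D(b) = {P}`, so `P` itself misses `g`.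
  have key : ∀ (g : C(X, ℝ)) (z : X), g z ≠ 0 → b z ≠ 0 → g ∉ P.1.asIdeal := by
    intro g z hg hbz hgP
    have hne : g * b ≠ 0 := fun h => mul_ne_zero hg hbz (DFunLike.congr_fun h z)
    obtain ⟨Q, hQ⟩ := MinimalPrimeSpace.exists_notMem hne
    obtain rfl : Q = P := (hb Q).1 fun h => hQ (Ideal.mul_mem_left _ _ h)
    exact hQ (Ideal.mul_mem_right _ _ hgP)
  obtain ⟨g, hgx, hgU⟩ := exists_ne_zero_of_mem_isOpen hU hxU
  obtain ⟨h, hhy, hhV⟩ := exists_ne_zero_of_mem_isOpen hV hyV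
  have hgh : g * h = 0 := by
    ext z
    by_cases hz : z ∈ U
    · simp [hhV z (Set.disjoint_left.1 hUV hz)]
    · simp [hgU z hz]
  exact (P.1.2.mem_or_mem (hgh ▸ P.1.asIdeal.zero_mem : g * h ∈ P.1.asIdeal)).elim
    (key g x hgx hx) (key h y hhy hy)

end ContinuousFunctions

theorem corollary3p10 (X : Type*) [TopologicalSpace X] [T35Space X] :
    Dense (isolatedPoints X) ↔ Dense (isolatedPoints (MinimalPrimeSpace C(X, ℝ))) := by
  rw [MinimalPrimeSpace.dense_isolatedPoints_iff]
  constructor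
  · intro hX f hf
    obtain ⟨z, hz⟩ := DFunLike.ne_iff.1 hf
    obtain ⟨x, hfx, hx⟩ := hX.inter_open_nonempty {y | f y ≠ 0}
      (isOpen_ne_fun f.continuous continuous_const) ⟨z, hz⟩
    obtain ⟨P, hP, hmem⟩ := ContinuousMap.exists_isolated_minimalPrime hx
    exact ⟨P, hP, fun h => hfx ((hmem f).1 h)⟩
  · intro h
    refine dense_iff_inter_open.2 fun U hU ⟨z, hz⟩ => ?_
    obtain ⟨f, hfz, hfU⟩ := ContinuousMap.exists_ne_zero_of_mem_isOpen hU hz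
    obtain ⟨P, hP, hfP⟩ := h f fun h0 => hfz (DFunLike.congr_fun h0 z)
    -- Taking a multiple of `f` keeps the nonzero set inside `U`.
    obtain ⟨a, ha⟩ := MinimalPrimeSpace.exists_mul_notMem_iff_eq hP hfP
    have hne : a * f ≠ 0 := fun h0 => (ha P).2 rfl (h0 ▸ P.1.asIdeal.zero_mem)
    obtain ⟨x, hx⟩ := DFunLike.ne_iff.1 hne
    have hxU : x ∈ U := by
      by_contra hxU
      exact hx (by simp [hfU x hxU])
    refine ⟨x, hxU, ?_⟩
    have hset : {y | (a * f) y ≠ 0} = {x} := by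
      ext y
      constructor
      · exact fun hy => ContinuousMap.eq_of_ne_zero_of_notMem_iff_eq ha hy hx
      · rintro rfl
        exact hx
    have hopen : IsOpen {y | (a * f) y ≠ 0} :=
      isOpen_ne_fun (a * f).continuous continuous_const
    rwa [hset] at hopen
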